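/- For real $\nu$ let $J_\nu(x)=\sum_{k\ge 0}\frac{(-1)^k}{k!\,\Gamma(\nu+k+1)}\left(\frac x2\right)^{2k+\nu}$ be the Bessel function of the first kind, let $j_{\nu,1}<j_{\nu,2}<\cdots$ be its positive zeros, let $$R_{n,\nu}(x)=\sum_{k=0}^{\lfloor n/2\rfloor}(-1)^k\binom{n-k}{k}\frac{\Gamma(\nu+n-k)}{\Gamma(\nu+k)}\left(\frac x2\right)^{2k-n}\qquad(n=0,1,2,\dots)$$ be the Lommel polynomials, and let $W[f,g]=fg'-f'g$. Let $\nu>-1$ be real and let $m\ge 1$ be an integer. Let $x>0$, or, if $\nu$ is an integer, let $x\ne 0$ be any real number. Then $J_\nu$ and $R_{m-1,\nu+1}J_{\nu+m}$ are differentiable at $x$, and $$W[J_\nu,\,R_{m-1,\nu+1}J_{\nu+m}](x)=2J_{\nu+m}^2(x)\left[R_{m-1,\nu+1}^2(x)\sum_{k=1}^\infty\frac{x^2+j_{\nu+m,k}^2}{(x^2-j_{\nu+m,k}^2)^2}+\frac1{x^2}\sum_{k=0}^{m-1}(\nu+k+1)R_{k,\nu+1}^2(x)\right].$$ Here, if $J_{\nu+m}(x)\neq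 0$, the infinite series converges and the identity holds as written; if $J_{\nu+m}(x)=0$, the right-hand side has a removable singularity at $x$ and is understood as its limit there. In particular, $W[J_\nu,\,R_{m-1,\nu+1}J_{\nu+m}](x)\ge 0$. -/

import Mathlib

open Filter Topology

noncomputable section

namespace BesselLommel

/-- The Bessel function of the first kind `J_ν(x)`, as its defining power series. It is meant for
`x > 0`, and for every real `x ≠ 0` if `ν` is an integer. -/
def besselJ (ν x : ℝ) : ℝ :=
  ∑' k : ℕ, (-1 : ℝ) ^ k / ((k.factorial : ℝ) * Real.Gamma (ν + k + 1)) *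
    (x / 2) ^ (2 * (k : ℝ) + ν)

/-- `besselZero ν k = j_{ν,k}` for `k ≥ 1`: the `k`-th positive zero of `J_ν` in ascending order,
that is, the first zero of `J_ν` after `j_{ν,k-1}`, where the recursion starts at `j_{ν,0} = 0`. -/
def besselZero (ν : ℝ) : ℕ → ℝ
  | 0 => 0
  | k + 1 => sInf {x : ℝ | besselZero ν k < x ∧ besselJ ν x = 0}

/-- The Lommel polynomial `R_{m,ν}(x)`, a polynomial in `1/x`. -/
def lommelR (m : ℕ) (ν x : ℝ) : ℝ :=
  ∑ k ∈ Finset.range (m / 2 + 1),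
    (-1 : ℝ) ^ k * ((m - k).choose k : ℝ) *
      (Real.Gamma (ν + m - k) / Real.Gamma (ν + k)) * (x / 2) ^ (2 * (k : ℤ) - (m : ℤ))

/-- The Wronskian `W[f, g] = f g' - f' g`. -/
def wronskian (f g : ℝ → ℝ) (x : ℝ) : ℝ :=
  f x * deriv g x - deriv f x * g x

end BesselLommel

end

/-! Write μ = ν + m, so that μ ≥ 0, and abbreviate f = J_μ, g = J_{μ+1}, p = R_{m,ν+1}, r =
R_{m-1,ν+1}. The three-term recurrences give J_ν = p f - r g (`besselJ_eq_lommelR`), and bilinearity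
of the Wronskian yields W[J_ν, r f] = f² W[p, r] + r² W[f, g]. The recurrence of the Lommel
polynomials telescopes W[p, r] into the finite sum (`wronskian_lommelR`). What remains is W[J_μ,
J_{μ+1}] = 2 J_μ² ∑ (x² + j²)/(x² - j²)².

This expansion comes from the spectral theorem rather than from a product formula for J_μ. After
symmetrization, the recurrence in the order is a compact self-adjoint Jacobi operator T on ℓ². The
vectors v(x) with entries √(μ+k+1) J_{μ+k+1}(x), stripped of the power (x/2)^μ, satisfy x T v(x) =
v(x) - (multiple of J_μ(x)) e₀ (`smul_besselOp_besselVec`). Hence v(z) is an eigenvector for the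
eigenvalue 1/z at each nonzero zero z. These are all the eigenvectors up to scalars, and T has
trivial kernel, so the normalized v(z) form a Hilbert basis. Parseval applied to v(x)
(`hasSum_besselZeros`) expands ‖v(x)‖², which is W[J_μ, J_{μ+1}] up to elementary factors
(`norm_besselVec_sq`, `besselW_eq`), as a sum of multiples of 1/(z - x)². Pairing z = ±j gives the
claim.

At zeros of J_μ the formula extends because the Wronskian is continuous and the zeros are isolated.
Nonnegativity holds because both Wronskians are sums of squares with nonnegative weights. -/

namespace BesselLommel

/-! ### The Bessel–Clifford function -/

/-- The entire factor of the Bessel function: `J_ν(x) = (x / 2) ^ ν * besselClifford ν (x² / 4)`. -/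
noncomputable def besselClifford (ν t : ℝ) : ℝ :=
  ∑' k : ℕ, (-1 : ℝ) ^ k / ((k.factorial : ℝ) * Real.Gamma (ν + k + 1)) * t ^ k

theorem Gamma_le_Gamma_add_nat {s : ℝ} (hs : 1 ≤ s) (k : ℕ) :
    Real.Gamma s ≤ Real.Gamma (s + k) := by
  induction k with
  | zero => simp
  | succ k ih =>
    have h : (0 : ℝ) ≤ k := k.cast_nonneg
    have : s + (k + 1 : ℕ) = (s + k) + 1 := by push_cast; ring
    rw [this, Real.Gamma_add_one (by linarith)]
    nlinarith [Real.Gamma_pos_of_pos (show 0 < s by linarith)]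

theorem exists_pos_le_Gamma {ν : ℝ} (hν : -1 < ν) :
    ∃ c : ℝ, 0 < c ∧ ∀ k : ℕ, c ≤ Real.Gamma (ν + k + 1) := by
  -- The argument ν + 1 may lie in (0, 1), where a unit shift decreases Γ; from ν + 2 ≥ 1 on, unit
  -- shifts no longer decrease it.
  refine ⟨min (Real.Gamma (ν + 1)) (Real.Gamma (ν + 2)), lt_min
    (Real.Gamma_pos_of_pos (by linarith)) (Real.Gamma_pos_of_pos (by linarith)), fun k => ?_⟩
  rcases k with _ | k
  · simp
  · refine (min_le_right _ _).trans ((Gamma_le_Gamma_add_nat (by linarith) k).trans_eq ?_)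
    congr 1; push_cast; ring

theorem norm_clifford_coeff_le {ν c : ℝ} (hc : 0 < c)
    (h : ∀ k : ℕ, c ≤ Real.Gamma (ν + k + 1)) (k : ℕ) :
    ‖(-1 : ℝ) ^ k / ((k.factorial : ℝ) * Real.Gamma (ν + k + 1))‖ ≤ c⁻¹ * (1 / k.factorial) := by
  have hk : (0 : ℝ) < k.factorial := by positivity
  have h0 : 0 < Real.Gamma (ν + k + 1) := hc.trans_le (h k)
  rw [norm_div, norm_pow, norm_neg, norm_one, one_pow, Real.norm_of_nonneg (by positivity),
    one_div, one_div, mul_inv, mul_comm]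
  gcongr
  exact h k

theorem summable_besselClifford {ν : ℝ} (hν : -1 < ν) (t : ℝ) :
    Summable fun k : ℕ =>
      (-1 : ℝ) ^ k / ((k.factorial : ℝ) * Real.Gamma (ν + k + 1)) * t ^ k := by
  obtain ⟨c, hc, h⟩ := exists_pos_le_Gamma hν
  refine Summable.of_norm_bounded ((Real.summable_pow_div_factorial |t|).mul_left c⁻¹) fun k => ?_
  rw [norm_mul, norm_pow, Real.norm_eq_abs t]
  calc _ ≤ c⁻¹ * (1 / k.factorial) * |t| ^ k := by gcongr; exact norm_clifford_coeff_le hc h k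
    _ = _ := by ring

theorem abs_besselClifford_le {ν : ℝ} (hν : 0 ≤ ν) (t : ℝ) :
    |besselClifford ν t| ≤ Real.exp |t| / Real.Gamma (ν + 1) := by
  have hc : 0 < Real.Gamma (ν + 1) := Real.Gamma_pos_of_pos (by linarith)
  have h : ∀ k : ℕ, Real.Gamma (ν + 1) ≤ Real.Gamma (ν + k + 1) := fun k => by
    refine (Gamma_le_Gamma_add_nat (by linarith) k).trans_eq (by congr 1; ring)
  have hs : HasSum (fun k : ℕ => |t| ^ k / k.factorial) (Real.exp |t|) := by
    rw [Real.exp_eq_exp_ℝ]; exact NormedSpace.expSeries_div_hasSum_exp |t|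
  rw [div_eq_inv_mul]
  rw [← Real.norm_eq_abs, besselClifford]
  refine tsum_of_norm_bounded (hs.mul_left _) fun k => ?_
  rw [norm_mul, norm_pow, Real.norm_eq_abs t]
  calc _ ≤ (Real.Gamma (ν + 1))⁻¹ * (1 / k.factorial) * |t| ^ k := by
        gcongr; exact norm_clifford_coeff_le hc h k
    _ = _ := by ring

theorem hasDerivAt_besselClifford {ν : ℝ} (hν : -1 < ν) (t : ℝ) :
    HasDerivAt (besselClifford ν) (-besselClifford (ν + 1) t) t := by
  obtain ⟨c, hc, h⟩ := exists_pos_le_Gamma hν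
  set a : ℕ → ℝ := fun k => (-1 : ℝ) ^ k / ((k.factorial : ℝ) * Real.Gamma (ν + k + 1)) with ha
  set r := |t| + 1
  have hr : 0 < r := by positivity
  have hu : Summable fun k : ℕ => c⁻¹ * (1 / k.factorial) * (k * r ^ (k - 1)) := by
    rw [← summable_nat_add_iff 1]
    refine ((Real.summable_pow_div_factorial r).mul_left c⁻¹).congr fun k => ?_
    rw [Nat.factorial_succ]
    push_cast
    have : (k : ℝ) + 1 ≠ 0 := by positivity
    have : (k.factorial : ℝ) ≠ 0 := by positivity
    field_simp
  have key := hasDerivAt_tsum_of_isPreconnected (t := Metric.ball (0 : ℝ) r)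
    (g := fun k y => a k * y ^ k) (g' := fun k y => a k * (k * y ^ (k - 1))) (y₀ := t) (y := t) hu
    Metric.isOpen_ball (convex_ball _ _).isPreconnected
    (fun k y _ => (hasDerivAt_pow k y).const_mul (a k)) ?_ (by simp [r])
    (summable_besselClifford hν t) (by simp [r])
  · refine key.congr_deriv ?_
    have hs : Summable fun k : ℕ => a k * (k * t ^ (k - 1)) := by
      refine Summable.of_norm_bounded hu fun k => ?_
      rw [norm_mul, norm_mul, norm_pow, Real.norm_natCast]
      gcongr
      · exact norm_clifford_coeff_le hc h k
      · rw [Real.norm_eq_abs]; simp [r]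
    rw [hs.tsum_eq_zero_add, besselClifford, ← tsum_neg]
    simp only [Nat.cast_zero, zero_mul, mul_zero, zero_add]
    refine tsum_congr fun k => ?_
    have h1 : (k : ℝ) + 1 ≠ 0 := by positivity
    have h2 : (k.factorial : ℝ) ≠ 0 := by positivity
    have h3 : ν + 1 + k + 1 = ν + (k + 1 : ℕ) + 1 := by push_cast; ring
    have h4 := (hc.trans_le (h (k + 1))).ne'
    rw [h3]
    simp only [ha, Nat.factorial_succ, pow_succ, Nat.add_sub_cancel]
    push_cast at h4 ⊢
    field_simp
  · intro k y hy
    rw [norm_mul, norm_mul, norm_pow, Real.norm_natCast]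
    gcongr
    · exact norm_clifford_coeff_le hc h k
    · simpa using (mem_ball_zero_iff.1 hy).le

theorem besselClifford_recurrence {ν : ℝ} (hν : -1 < ν) (t : ℝ) :
    besselClifford ν t =
      (ν + 1) * besselClifford (ν + 1) t - t * besselClifford (ν + 2) t := by
  have h0 := summable_besselClifford hν t
  have h1 := summable_besselClifford (show -1 < ν + 1 by linarith) t
  have h2 := summable_besselClifford (show -1 < ν + 2 by linarith) t
  rw [besselClifford, besselClifford, besselClifford, ← tsum_mul_left, ← tsum_mul_left,
    h0.tsum_eq_zero_add, (h1.mul_left (ν + 1)).tsum_eq_zero_add, add_sub_assoc,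
    ← (((summable_nat_add_iff 1).2 h1).mul_left (ν + 1)).tsum_sub (h2.mul_left t)]
  congr 1
  · have : Real.Gamma (ν + 1) ≠ 0 := (Real.Gamma_pos_of_pos (by linarith)).ne'
    have h' : ν + 1 ≠ 0 := by linarith
    simp only [Nat.cast_zero, add_zero, pow_zero, Nat.factorial_zero, Nat.cast_one, one_mul,
      mul_one, Real.Gamma_add_one h']
    field_simp
  · refine tsum_congr fun k => ?_
    have hk : (0 : ℝ) ≤ k := k.cast_nonneg
    have h1 : (k : ℝ) + 1 ≠ 0 := by positivity
    have h2 : (k.factorial : ℝ) ≠ 0 := by positivity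
    have h3 : Real.Gamma (ν + k + 2) ≠ 0 := (Real.Gamma_pos_of_pos (by linarith)).ne'
    have h4 : ν + k + 2 ≠ 0 := by linarith
    have e1 : ν + (k + 1 : ℕ) + 1 = ν + k + 2 := by push_cast; ring
    have e2 : ν + 1 + (k + 1 : ℕ) + 1 = ν + k + 2 + 1 := by push_cast; ring
    have e3 : ν + 2 + k + 1 = ν + k + 2 + 1 := by ring
    rw [e1, e2, e3, Real.Gamma_add_one h4, Nat.factorial_succ]
    push_cast
    field_simp
    ring

theorem besselClifford_zero_right (ν : ℝ) : besselClifford ν 0 = (Real.Gamma (ν + 1))⁻¹ := by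
  rw [besselClifford, tsum_eq_single 0 fun k hk => by simp [hk]]
  simp

/-- By the mean value inequality the function moves from its value 1/Γ(ν+1) at 0 by at most |t|
exp|t| / Γ(ν+2), which is smaller. So at a fixed point only small orders can vanish. -/
theorem besselClifford_ne_zero_of_lt {ν t : ℝ} (hν : 0 ≤ ν) (h : |t| * Real.exp |t| < ν + 1) :
    besselClifford ν t ≠ 0 := by
  have hc : 0 < Real.Gamma (ν + 1) := Real.Gamma_pos_of_pos (by linarith)
  have hb : ∀ s ∈ Metric.closedBall (0 : ℝ) |t|,
      ‖-besselClifford (ν + 1) s‖ ≤ Real.exp |t| / Real.Gamma (ν + 1 + 1) := fun s hs => by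
    rw [norm_neg]
    refine (abs_besselClifford_le (by linarith) s).trans ?_
    have := (Real.Gamma_pos_of_pos (show 0 < ν + 1 + 1 by linarith)).le
    exact div_le_div_of_nonneg_right (Real.exp_le_exp.2 (by simpa using hs)) this
  have key := (convex_closedBall (0 : ℝ) |t|).norm_image_sub_le_of_norm_hasDerivWithin_le
    (fun s _ => (hasDerivAt_besselClifford (show -1 < ν by linarith) s).hasDerivWithinAt) hb
    (x := 0) (y := t) (by simp) (by simp)
  intro h0
  rw [h0, besselClifford_zero_right, zero_sub, norm_neg, norm_inv, Real.norm_of_nonneg hc.le,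
    sub_zero, Real.norm_eq_abs, Real.Gamma_add_one (show ν + 1 ≠ 0 by linarith), div_mul_eq_mul_div,
    le_div_iff₀ (by positivity), mul_comm (ν + 1), ← mul_assoc, inv_mul_cancel₀ hc.ne'] at key
  linarith

/-! ### The Bessel function -/

theorem besselJ_eq (ν : ℝ) {x : ℝ} (hx : x ≠ 0) :
    besselJ ν x = (x / 2) ^ ν * besselClifford ν (x ^ 2 / 4) := by
  rw [besselJ, besselClifford, ← tsum_mul_left]
  refine tsum_congr fun k => ?_
  have h := Real.rpow_add_natCast (show x / 2 ≠ 0 by positivity) ν (2 * k)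
  push_cast at h
  rw [add_comm (2 * (k : ℝ)), h, pow_mul, div_pow]
  ring

theorem hasDerivAt_besselJ {ν : ℝ} (hν : -1 < ν) {x : ℝ} (hx : x ≠ 0) :
    HasDerivAt (besselJ ν) (ν / x * besselJ ν x - besselJ (ν + 1) x) x := by
  have hx2 : x / 2 ≠ 0 := by positivity
  have h1 : HasDerivAt (fun y : ℝ => (y / 2) ^ ν) (1 / 2 * ν * (x / 2) ^ (ν - 1)) x :=
    ((hasDerivAt_id x).div_const 2).rpow_const (Or.inl hx2)
  have h2 : HasDerivAt (fun y : ℝ => y ^ 2 / 4) (x / 2) x :=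
    ((hasDerivAt_pow 2 x).div_const 4).congr_deriv (by norm_num; ring)
  have h3 := h1.mul ((hasDerivAt_besselClifford hν (x ^ 2 / 4)).comp x h2)
  have he : besselJ ν =ᶠ[𝓝 x] fun y => (y / 2) ^ ν * besselClifford ν (y ^ 2 / 4) :=
    (eventually_ne_nhds hx).mono fun y hy => besselJ_eq ν hy
  refine (h3.congr_of_eventuallyEq he).congr_deriv ?_
  rw [besselJ_eq _ hx, besselJ_eq _ hx, Real.rpow_add_one hx2, Real.rpow_sub_one hx2]
  simp only [Function.comp]
  field_simp
  ring

theorem besselJ_recurrence {ν : ℝ} (hν : -1 < ν) {x : ℝ} (hx : x ≠ 0) :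
    besselJ ν x = 2 * (ν + 1) / x * besselJ (ν + 1) x - besselJ (ν + 2) x := by
  have hx2 : x / 2 ≠ 0 := by positivity
  have h : (x / 2) ^ (ν + 2) = (x / 2) ^ ν * (x / 2) ^ 2 := by
    exact_mod_cast Real.rpow_add_natCast hx2 ν 2
  rw [besselJ_eq _ hx, besselJ_eq _ hx, besselJ_eq _ hx, besselClifford_recurrence hν,
    Real.rpow_add_one hx2, h]
  field_simp
  ring

/-! ### Lommel polynomials -/

theorem lommelR_eq_sum {m N : ℕ} (h : m / 2 + 1 ≤ N) (ν x : ℝ) :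
    lommelR m ν x = ∑ k ∈ Finset.range N, (-1 : ℝ) ^ k * ((m - k).choose k : ℝ) *
      (Real.Gamma (ν + m - k) / Real.Gamma (ν + k)) * (x / 2) ^ (2 * (k : ℤ) - (m : ℤ)) := by
  refine Finset.sum_subset (Finset.range_mono h) fun k _ hk => ?_
  have : m - k < k := by simp only [Finset.mem_range] at hk; omega
  simp [Nat.choose_eq_zero_of_lt this]

theorem lommelR_zero {ν : ℝ} (hν : 0 < ν) (x : ℝ) : lommelR 0 ν x = 1 := by
  simp [lommelR, (Real.Gamma_pos_of_pos hν).ne']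

theorem lommelR_one {ν : ℝ} (hν : 0 < ν) (x : ℝ) : lommelR 1 ν x = 2 * ν / x := by
  have := (Real.Gamma_pos_of_pos hν).ne'
  simp [lommelR, Real.Gamma_add_one hν.ne']
  field_simp

/-- Coefficients are compared: term k + 1 of the sums for n + 2 and n + 1 goes with term k of the
sum for n, and the two terms of index 0 are matched separately. -/
theorem lommelR_recurrence {ν : ℝ} (hν : 0 < ν) (n : ℕ) {x : ℝ} (hx : x ≠ 0) :
    lommelR (n + 2) ν x =
      2 * (ν + n + 1) / x * lommelR (n + 1) ν x - lommelR n ν x := by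
  have hx2 : x / 2 ≠ 0 := by positivity
  rw [lommelR_eq_sum (show (n + 2) / 2 + 1 ≤ n / 2 + 2 by omega),
    lommelR_eq_sum (show (n + 1) / 2 + 1 ≤ n / 2 + 2 by omega), lommelR, Finset.sum_range_succ',
    Finset.sum_range_succ' _ (n / 2 + 1), mul_add, Finset.mul_sum, add_sub_right_comm
      (∑ _k ∈ _, _),
    ← Finset.sum_sub_distrib]
  congr 1
  · refine Finset.sum_congr rfl fun k hk => ?_
    obtain ⟨N, rfl⟩ : ∃ N, n = N + k := ⟨n - k, by simp only [Finset.mem_range] at hk; omega⟩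
    have e1 : N + k + 2 - (k + 1) = N + 1 := by omega
    have e2 : N + k + 1 - (k + 1) = N := by omega
    have e3 : N + k - k = N := by omega
    have c1 : (2 * ((k + 1 : ℕ) : ℤ) - ((N + k + 2 : ℕ) : ℤ)) = (k : ℤ) - N := by push_cast; ring
    have c2 : (2 * ((k + 1 : ℕ) : ℤ) - ((N + k + 1 : ℕ) : ℤ)) = (k : ℤ) - N + 1 := by
      push_cast; ring
    have c3 : (2 * (k : ℤ) - ((N + k : ℕ) : ℤ)) = (k : ℤ) - N := by push_cast; ring
    rw [e1, e2, e3, c1, c2, c3, zpow_add_one₀ hx2]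
    have d1 : ν + ((N + k + 2 : ℕ) : ℝ) - ((k + 1 : ℕ) : ℝ) = ν + N + 1 := by push_cast; ring
    have d2 : ν + ((N + k + 1 : ℕ) : ℝ) - ((k + 1 : ℕ) : ℝ) = ν + N := by push_cast; ring
    have d3 : ν + ((N + k : ℕ) : ℝ) - (k : ℝ) = ν + N := by push_cast; ring
    have d4 : ν + ((k + 1 : ℕ) : ℝ) = ν + k + 1 := by push_cast; ring
    have p1 : ν + N ≠ 0 := by positivity
    have p2 : ν + k ≠ 0 := by positivity
    have p3 : Real.Gamma (ν + k) ≠ 0 := (Real.Gamma_pos_of_pos (by positivity)).ne'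
    rw [d1, d2, d3, d4, Real.Gamma_add_one p1, Real.Gamma_add_one p2]
    have hch : ((N + 1).choose (k + 1) : ℝ) = N.choose k + N.choose (k + 1) := by
      exact_mod_cast Nat.choose_succ_succ N k
    have hch2 : (N.choose (k + 1) : ℝ) * (k + 1) = N.choose k * ((N : ℝ) - k) := by
      rcases le_or_gt k N with h | h
      · have := Nat.choose_succ_right_eq N k
        rw [← Nat.cast_sub h]; exact_mod_cast this
      · simp [Nat.choose_eq_zero_of_lt h, Nat.choose_eq_zero_of_lt (Nat.lt_succ_of_lt h)]
    rw [hch]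
    push_cast
    field_simp
    linear_combination (-1) ^ k * hch2
  · have h1 : Real.Gamma ν ≠ 0 := (Real.Gamma_pos_of_pos hν).ne'
    have e : (2 * ((0 : ℕ) : ℤ) - ((n + 1 : ℕ) : ℤ)) = (2 * ((0 : ℕ) : ℤ) - ((n + 2 : ℕ) : ℤ)) + 1 := by
      push_cast; ring
    have d : ν + ((n + 2 : ℕ) : ℝ) - ((0 : ℕ) : ℝ) = (ν + n + 1) + 1 := by push_cast; ring
    have d2 : ν + ((n + 1 : ℕ) : ℝ) - ((0 : ℕ) : ℝ) = ν + n + 1 := by push_cast; ring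
    rw [e, zpow_add_one₀ hx2, d, d2, Real.Gamma_add_one (by positivity)]
    simp only [pow_zero, Nat.choose_zero_right, Nat.cast_one]
    field_simp

/-! ### Symmetric Jacobi operators with zero diagonal on `ℓ²(ℕ)` -/

/-- The real Hilbert space `ℓ²(ℕ)`. -/
abbrev Ell2 : Type := lp (fun _ : ℕ => ℝ) 2

/-- The standard unit vectors of `ℓ²(ℕ)`. -/
noncomputable def unitVec (k : ℕ) : Ell2 := lp.single 2 k (1 : ℝ)

theorem unitVec_apply (k i : ℕ) : unitVec k i = if i = k then 1 else 0 := by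
  simp [unitVec, Pi.single_apply]

theorem inner_unitVec (k : ℕ) (f : Ell2) : inner ℝ (unitVec k) f = f k := by
  simp [unitVec, lp.inner_single_left]

theorem Ell2.hasSum_sq (f : Ell2) : HasSum (fun k => f k ^ 2) (‖f‖ ^ 2) := by
  simpa [sq, real_inner_self_eq_norm_sq] using lp.hasSum_inner (𝕜 := ℝ) f f

theorem memℓp_two_of_summable_sq {f : ℕ → ℝ} (hf : Summable fun k => f k ^ 2) :
    Memℓp f 2 := by
  refine memℓp_gen (hf.congr fun k => ?_)
  simp

theorem Ell2.norm_le_mul_of_abs_le {f g : Ell2} {C : ℝ} (hC : 0 ≤ C)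
    (h : ∀ k, |g k| ≤ C * |f (k + 1)|) : ‖g‖ ≤ C * ‖f‖ := by
  refine abs_le_of_sq_le_sq' ?_ (by positivity) |>.2
  rw [mul_pow]
  have hf := (Ell2.hasSum_sq f).summable
  calc ‖g‖ ^ 2 = ∑' k, g k ^ 2 := (Ell2.hasSum_sq g).tsum_eq.symm
    _ ≤ ∑' k, C ^ 2 * f (k + 1) ^ 2 := by
        refine (Ell2.hasSum_sq g).summable.tsum_le_tsum (fun k => ?_)
          (((summable_nat_add_iff 1).2 hf).mul_left _)
        rw [← sq_abs, ← sq_abs (f (k + 1)), ← mul_pow]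
        exact pow_le_pow_left₀ (abs_nonneg _) (h k) 2
    _ ≤ C ^ 2 * ‖f‖ ^ 2 := by
        rw [tsum_mul_left, ← (Ell2.hasSum_sq f).tsum_eq, hf.tsum_eq_zero_add]
        nlinarith [mul_nonneg (sq_nonneg C) (sq_nonneg (f 0))]

/-- The weighted backward shift `f ↦ (c k * f (k + 1))ₖ`. -/
noncomputable def weightedShift (c : ℕ → ℝ) (C : ℝ) (h : ∀ k, |c k| ≤ C) : Ell2 →L[ℝ] Ell2 :=
  LinearMap.mkContinuous
    { toFun := fun f => ⟨fun k => c k * f (k + 1), memℓp_two_of_summable_sq <| by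
        refine Summable.of_nonneg_of_le (fun k => sq_nonneg _) (fun k => ?_)
          (((summable_nat_add_iff 1).2 (Ell2.hasSum_sq f).summable).mul_left (C ^ 2))
        rw [mul_pow, ← sq_abs (c k)]
        have := h k
        gcongr⟩
      map_add' := fun f g => by ext k; exact mul_add _ _ _
      map_smul' := fun a f => by ext k; simp [mul_left_comm] }
    C fun f => Ell2.norm_le_mul_of_abs_le ((abs_nonneg _).trans (h 0)) fun k => by
      simpa [abs_mul] using mul_le_mul_of_nonneg_right (h k) (abs_nonneg _)

theorem weightedShift_apply (c : ℕ → ℝ) (C : ℝ) (h : ∀ k, |c k| ≤ C) (f : Ell2) (k : ℕ) :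
    weightedShift c C h f k = c k * f (k + 1) := rfl

/-- The Jacobi operator with zero diagonal and off-diagonal entries `c k`. -/
noncomputable def jacobiOp (c : ℕ → ℝ) (C : ℝ) (h : ∀ k, |c k| ≤ C) : Ell2 →L[ℝ] Ell2 :=
  weightedShift c C h + ContinuousLinearMap.adjoint (weightedShift c C h)

theorem adjoint_weightedShift_apply (c : ℕ → ℝ) (C : ℝ) (h : ∀ k, |c k| ≤ C) (f : Ell2) (k : ℕ) :
    ContinuousLinearMap.adjoint (weightedShift c C h) f k =
      inner ℝ (weightedShift c C h (unitVec k)) f := by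
  rw [← inner_unitVec, ContinuousLinearMap.adjoint_inner_right]

theorem jacobiOp_apply_zero (c : ℕ → ℝ) (C : ℝ) (h : ∀ k, |c k| ≤ C) (f : Ell2) :
    jacobiOp c C h f 0 = c 0 * f 1 := by
  have : weightedShift c C h (unitVec 0) = 0 := by
    ext k; simp [weightedShift_apply, unitVec_apply]
  change weightedShift c C h f 0 + ContinuousLinearMap.adjoint (weightedShift c C h) f 0 = _
  rw [adjoint_weightedShift_apply, this, inner_zero_left, weightedShift_apply, add_zero]

theorem jacobiOp_apply_succ (c : ℕ → ℝ) (C : ℝ) (h : ∀ k, |c k| ≤ C) (f : Ell2) (k : ℕ) :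
    jacobiOp c C h f (k + 1) = c (k + 1) * f (k + 2) + c k * f k := by
  have : weightedShift c C h (unitVec (k + 1)) = c k • unitVec k := by
    ext i
    simp only [weightedShift_apply, unitVec_apply, lp.coeFn_smul, Pi.smul_apply, smul_eq_mul,
      add_left_inj]
    split_ifs with hi
    · rw [hi]
    · simp
  change weightedShift c C h f (k + 1) +
    ContinuousLinearMap.adjoint (weightedShift c C h) f (k + 1) = _
  rw [adjoint_weightedShift_apply, this, real_inner_smul_left, inner_unitVec, weightedShift_apply]

theorem isSymmetric_jacobiOp (c : ℕ → ℝ) (C : ℝ) (h : ∀ k, |c k| ≤ C) :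
    (jacobiOp c C h).IsSymmetric :=
  ContinuousLinearMap.isSelfAdjoint_iff_isSymmetric.1
    (IsSelfAdjoint.add_star_self (weightedShift c C h))

theorem isCompactOperator_rankOne {E : Type*} [NormedAddCommGroup E] [InnerProductSpace ℝ E]
    (x y : E) : IsCompactOperator (InnerProductSpace.rankOne ℝ x y) := by
  have h : IsCompactOperator (id : ℝ → ℝ) :=
    (isCompactOperator_id_iff_finiteDimensional (𝕜 := ℝ)).2 inferInstance
  exact (h.comp_clm (innerSL ℝ y)).clm_comp (ContinuousLinearMap.toSpanSingleton ℝ x)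

/-- Truncating the weights leaves finite-rank operators, which converge in norm because the
discarded weights are uniformly small. -/
theorem isCompactOperator_jacobiOp (c : ℕ → ℝ) (C : ℝ) (h : ∀ k, |c k| ≤ C)
    (hc : Tendsto c atTop (𝓝 0)) : IsCompactOperator (jacobiOp c C h) := by
  set B : ℕ → Ell2 →L[ℝ] Ell2 := fun N =>
    ∑ k ∈ Finset.range N, c k • InnerProductSpace.rankOne ℝ (unitVec k) (unitVec (k + 1))
  have hB : Tendsto B atTop (𝓝 (weightedShift c C h)) := by
    rw [Metric.tendsto_atTop]
    intro ε hε
    obtain ⟨N, hN⟩ := Metric.tendsto_atTop.1 hc (ε / 2) (by positivity)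
    refine ⟨N, fun n hn => ?_⟩
    rw [dist_eq_norm, norm_sub_rev]
    refine (ContinuousLinearMap.opNorm_le_bound _ (half_pos hε).le fun f =>
      Ell2.norm_le_mul_of_abs_le (half_pos hε).le fun k => ?_).trans_lt (half_lt_self hε)
    have hBk : B n f k = if k < n then c k * f (k + 1) else 0 := by
      simp only [B, sum_apply, smul_apply,
        InnerProductSpace.rankOne_apply, lp.coeFn_sum, Finset.sum_apply, lp.coeFn_smul,
        Pi.smul_apply, smul_eq_mul, inner_unitVec, unitVec_apply]
      simp
    rw [sub_apply, lp.coeFn_sub, Pi.sub_apply, hBk, weightedShift_apply]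
    split_ifs with hk
    · simpa using by positivity
    · rw [sub_zero, abs_mul]
      have := hN k (by omega)
      rw [dist_zero_right, Real.norm_eq_abs] at this
      gcongr
  have hT : Tendsto (fun N => B N + ContinuousLinearMap.adjoint (B N)) atTop
      (𝓝 (jacobiOp c C h)) :=
    hB.add ((ContinuousLinearMap.adjoint.continuous.tendsto _).comp hB)
  refine isCompactOperator_of_tendsto hT (Eventually.of_forall fun N => ?_)
  simp only [B, map_sum, map_smulₛₗ, InnerProductSpace.adjoint_rankOne]
  rw [← Finset.sum_add_distrib]
  refine Submodule.sum_mem (compactOperator (RingHom.id ℝ) Ell2 Ell2) fun k _ => ?_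
  exact ((isCompactOperator_rankOne _ _).smul (c k)).add
    ((isCompactOperator_rankOne _ _).smul (c k))

/-- The rows of the eigenvalue equation determine all entries successively from the first one;
eigenspaces are thus at most one-dimensional. -/
theorem eq_zero_of_jacobiOp_eq_smul {c : ℕ → ℝ} {C : ℝ} {h : ∀ k, |c k| ≤ C} (hc : ∀ k, c k ≠ 0)
    {f : Ell2} {a : ℝ} (hf : jacobiOp c C h f = a • f) (h0 : f 0 = 0) : f = 0 := by
  have key : ∀ k, f k = 0 ∧ f (k + 1) = 0 := by
    intro k
    induction k with
    | zero =>
      have := congrArg (fun g : Ell2 => g 0) hf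
      simp only [jacobiOp_apply_zero, lp.coeFn_smul, Pi.smul_apply, h0, smul_zero] at this
      exact ⟨h0, (mul_eq_zero.1 this).resolve_left (hc 0)⟩
    | succ k ih =>
      have := congrArg (fun g : Ell2 => g (k + 1)) hf
      simp only [jacobiOp_apply_succ, lp.coeFn_smul, Pi.smul_apply, ih.1, ih.2, smul_zero,
        mul_zero, add_zero] at this
      exact ⟨ih.2, (mul_eq_zero.1 this).resolve_left (hc (k + 1))⟩
  ext k
  exact (key k).1

/-- With decreasing weights, c (k+1) f (k+2) = -c k f k makes |f (2n)| nondecreasing, while square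
summability sends it to 0; hence f 0 = 0. -/
theorem eq_zero_of_jacobiOp_eq_zero {c : ℕ → ℝ} {C : ℝ} {h : ∀ k, |c k| ≤ C} (hc : ∀ k, 0 < c k)
    (hmono : Antitone c) {f : Ell2} (hf : jacobiOp c C h f = 0) : f = 0 := by
  refine eq_zero_of_jacobiOp_eq_smul (fun k => (hc k).ne') (a := 0) (by rw [hf, zero_smul]) ?_
  have hstep : ∀ k, |f k| ≤ |f (k + 2)| := by
    intro k
    have := congrArg (fun g : Ell2 => g (k + 1)) hf
    simp only [jacobiOp_apply_succ, lp.coeFn_zero, Pi.zero_apply] at this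
    have h1 : c (k + 1) * |f (k + 2)| = c k * |f k| := by
      rw [← abs_of_pos (hc (k + 1)), ← abs_of_pos (hc k), ← abs_mul, ← abs_mul,
        eq_neg_of_add_eq_zero_left this, abs_neg]
    have h2 : c (k + 1) * |f k| ≤ c (k + 1) * |f (k + 2)| := by
      rw [h1]; exact mul_le_mul_of_nonneg_right (hmono k.le_succ) (abs_nonneg _)
    exact le_of_mul_le_mul_left h2 (hc _)
  have hle : ∀ n, |f 0| ≤ |f (2 * n)| := by
    intro n
    induction n with
    | zero => simp
    | succ n ih => exact ih.trans (hstep _)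
  have ht : Tendsto (fun n => f (2 * n) ^ 2) atTop (𝓝 0) :=
    (Ell2.hasSum_sq f).summable.tendsto_atTop_zero.comp
      (tendsto_id.const_mul_atTop' (by norm_num : 0 < 2))
  have : f 0 ^ 2 ≤ 0 := ge_of_tendsto' ht fun n => sq_le_sq.2 (hle n)
  exact pow_eq_zero_iff (two_ne_zero) |>.1 (le_antisymm this (sq_nonneg _))

/-! ### The recessive solution of the Bessel recurrence -/

/-- `besselG μ k x = (x / 2) ^ (-μ) * J_{μ+k}(x)`, as a function of every real `x`. -/
noncomputable def besselG (μ : ℝ) (k : ℕ) (x : ℝ) : ℝ :=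
  (x / 2) ^ k * besselClifford (μ + k) (x ^ 2 / 4)

theorem besselJ_add_nat_eq (μ : ℝ) (k : ℕ) {x : ℝ} (hx : x ≠ 0) :
    besselJ (μ + k) x = (x / 2) ^ μ * besselG μ k x := by
  rw [besselJ_eq _ hx, Real.rpow_add_natCast (by positivity), besselG, mul_assoc]

theorem besselJ_eq_mul_besselG (μ : ℝ) {x : ℝ} (hx : x ≠ 0) :
    besselJ μ x = (x / 2) ^ μ * besselG μ 0 x := by
  simpa using besselJ_add_nat_eq μ 0 hx

theorem besselG_zero_neg (μ x : ℝ) : besselG μ 0 (-x) = besselG μ 0 x := by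
  simp [besselG]

theorem besselG_recurrence {μ : ℝ} (hμ : -1 < μ) (k : ℕ) (x : ℝ) :
    x * (besselG μ k x + besselG μ (k + 2) x) = 2 * (μ + k + 1) * besselG μ (k + 1) x := by
  have hk : (0 : ℝ) ≤ k := k.cast_nonneg
  have h := besselClifford_recurrence (show -1 < μ + k by linarith) (x ^ 2 / 4)
  simp only [besselG]
  push_cast
  rw [h, ← add_assoc, ← add_assoc]
  ring

/-- Factorial growth of Γ(μ+k+1) beats (x/2)^k. This decay removes the boundary term of the
telescoping sum in `hasSum_besselG_sq`. -/
theorem tendsto_besselG {μ : ℝ} (hμ : 0 ≤ μ) (x : ℝ) :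
    Tendsto (fun k => besselG μ k x) atTop (𝓝 0) := by
  have hc : 0 < Real.Gamma (μ + 1) := Real.Gamma_pos_of_pos (by linarith)
  have hG : ∀ k : ℕ, k.factorial * Real.Gamma (μ + 1) ≤ Real.Gamma (μ + k + 1) := by
    intro k
    induction k with
    | zero => simp
    | succ k ih =>
      have hk : (0 : ℝ) ≤ k := k.cast_nonneg
      have e : μ + (k + 1 : ℕ) + 1 = (μ + k + 1) + 1 := by push_cast; ring
      rw [e, Real.Gamma_add_one (show μ + k + 1 ≠ 0 by positivity), Nat.factorial_succ, Nat.cast_mul, mul_assoc]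
      push_cast
      exact mul_le_mul (by linarith) ih (by positivity) (by positivity)
  have ht := (FloorSemiring.tendsto_pow_div_factorial_atTop |x / 2|).const_mul
    (Real.exp |x ^ 2 / 4| / Real.Gamma (μ + 1))
  rw [mul_zero] at ht
  refine squeeze_zero_norm (fun k => ?_) ht
  rw [besselG, norm_mul, norm_pow, Real.norm_eq_abs, Real.norm_eq_abs]
  have h1 := abs_besselClifford_le (show 0 ≤ μ + k by positivity) (x ^ 2 / 4)
  calc _ ≤ |x / 2| ^ k * (Real.exp |x ^ 2 / 4| / Real.Gamma (μ + k + 1)) := by gcongr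
    _ ≤ |x / 2| ^ k * (Real.exp |x ^ 2 / 4| / (k.factorial * Real.Gamma (μ + 1))) := by
        gcongr; exact hG k
    _ = _ := by field_simp

/-- `x⁻¹ * besselD μ k x` is, up to a power of `x / 2`, the Wronskian of `J_{μ+k}` and
`J_{μ+k+1}`. -/
noncomputable def besselD (μ : ℝ) (k : ℕ) (x : ℝ) : ℝ :=
  x * (besselG μ (k + 1) x ^ 2 - besselG μ k x * besselG μ (k + 2) x) +
    besselG μ k x * besselG μ (k + 1) x

theorem besselD_sub {μ : ℝ} (hμ : -1 < μ) (k : ℕ) (x : ℝ) :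
    x * besselD μ k x - x * besselD μ (k + 1) x =
      2 * (μ + k + 1) * besselG μ (k + 1) x ^ 2 := by
  have a := besselG_recurrence hμ k x
  have b := besselG_recurrence hμ (k + 1) x
  push_cast at b
  simp only [besselD, add_assoc, Nat.reduceAdd] at a b ⊢
  linear_combination x * besselG μ (k + 1) x * b - x * besselG μ (k + 2) x * a +
    besselG μ (k + 1) x * a

theorem hasSum_besselG_sq {μ : ℝ} (hμ : 0 ≤ μ) (x : ℝ) :
    HasSum (fun k : ℕ => 2 * (μ + k + 1) * besselG μ (k + 1) x ^ 2) (x * besselD μ 0 x) := by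
  rw [hasSum_iff_tendsto_nat_of_nonneg fun k => by positivity]
  have h0 := tendsto_besselG hμ x
  have h1 := h0.comp (tendsto_add_atTop_nat 1)
  have h2 := h0.comp (tendsto_add_atTop_nat 2)
  have hD : Tendsto (fun n => besselD μ n x) atTop (𝓝 0) := by
    simpa [besselD] using (((h1.pow 2).sub (h0.mul h2)).const_mul x).add (h0.mul h1)
  have hs : ∀ n, ∑ k ∈ Finset.range n, 2 * (μ + k + 1) * besselG μ (k + 1) x ^ 2 =
      x * besselD μ 0 x - x * besselD μ n x := fun n => by
    rw [← Finset.sum_range_sub' (fun k => x * besselD μ k x)]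
    exact Finset.sum_congr rfl fun k _ => (besselD_sub (by linarith) k x).symm
  simp only [hs]
  simpa using (hD.const_mul x).const_sub (x * besselD μ 0 x)

/-- The vector `(√(μ+k+1) * besselG μ (k+1) x)ₖ` of `ℓ²(ℕ)`. -/
noncomputable def besselVec {μ : ℝ} (hμ : 0 ≤ μ) (x : ℝ) : Ell2 :=
  ⟨fun k => √(μ + k + 1) * besselG μ (k + 1) x, memℓp_two_of_summable_sq <|
    ((hasSum_besselG_sq hμ x).summable.mul_left (1 / 2)).congr fun k => by
      rw [mul_pow, Real.sq_sqrt (by positivity)]; ring⟩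

theorem besselVec_apply {μ : ℝ} (hμ : 0 ≤ μ) (x : ℝ) (k : ℕ) :
    besselVec hμ x k = √(μ + k + 1) * besselG μ (k + 1) x := rfl

theorem norm_besselVec_sq {μ : ℝ} (hμ : 0 ≤ μ) (x : ℝ) :
    ‖besselVec hμ x‖ ^ 2 = x * besselD μ 0 x / 2 := by
  refine (Ell2.hasSum_sq (besselVec hμ x)).unique ?_
  rw [div_eq_inv_mul]
  refine ((hasSum_besselG_sq hμ x).mul_left 2⁻¹).congr_fun fun k => ?_
  rw [besselVec_apply, mul_pow, Real.sq_sqrt (by positivity)]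
  ring

/-! ### The Jacobi operator of the Bessel recurrence -/

/-- The off-diagonal entries of the Jacobi operator attached to `J_μ`. -/
noncomputable def besselCoeff (μ : ℝ) (k : ℕ) : ℝ := (2 * √(μ + k + 1) * √(μ + k + 2))⁻¹

theorem besselCoeff_pos {μ : ℝ} (hμ : 0 ≤ μ) (k : ℕ) : 0 < besselCoeff μ k := by
  unfold besselCoeff; positivity

theorem antitone_besselCoeff {μ : ℝ} (hμ : 0 ≤ μ) : Antitone (besselCoeff μ) := by
  intro a b h
  have h' : (a : ℝ) ≤ b := by exact_mod_cast h
  unfold besselCoeff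
  gcongr

theorem abs_besselCoeff_le {μ : ℝ} (hμ : 0 ≤ μ) (k : ℕ) :
    |besselCoeff μ k| ≤ besselCoeff μ 0 := by
  rw [abs_of_pos (besselCoeff_pos hμ k)]
  exact antitone_besselCoeff hμ k.zero_le

theorem tendsto_besselCoeff {μ : ℝ} (hμ : 0 ≤ μ) : Tendsto (besselCoeff μ) atTop (𝓝 0) := by
  refine squeeze_zero (fun k => (besselCoeff_pos hμ k).le) (fun k => ?_)
    tendsto_one_div_add_atTop_nhds_zero_nat
  rw [besselCoeff, ← one_div]
  gcongr
  have h1 : √((k : ℝ) + 1) ≤ √(μ + k + 1) := Real.sqrt_le_sqrt (by linarith)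
  have h2 : √((k : ℝ) + 1) ≤ √(μ + k + 2) := Real.sqrt_le_sqrt (by linarith)
  have h3 := Real.mul_self_sqrt (show 0 ≤ (k : ℝ) + 1 by positivity)
  have h4 := mul_le_mul h1 h2 (Real.sqrt_nonneg _) (Real.sqrt_nonneg _)
  nlinarith [k.cast_nonneg (α := ℝ)]

/-- The compact self-adjoint operator whose eigenvalues are the reciprocals of the nonzero zeros
of `besselG μ 0`. -/
noncomputable def besselOp {μ : ℝ} (hμ : 0 ≤ μ) : Ell2 →L[ℝ] Ell2 :=
  jacobiOp (besselCoeff μ) (besselCoeff μ 0) (abs_besselCoeff_le hμ)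

/-- Each row is an instance of `besselG_recurrence`; only row 0 has no entry to carry the `besselG μ
0` term, whence the defect along `unitVec 0`. -/
theorem smul_besselOp_besselVec {μ : ℝ} (hμ : 0 ≤ μ) (x : ℝ) :
    x • besselOp hμ (besselVec hμ x) =
      besselVec hμ x - (x / 2 * besselG μ 0 x / √(μ + 1)) • unitVec 0 := by
  ext k
  rcases k with _ | k
  · have h := besselG_recurrence (show -1 < μ by linarith) 0 x
    simp only [lp.coeFn_smul, lp.coeFn_sub, Pi.smul_apply, Pi.sub_apply, smul_eq_mul, besselOp,
      jacobiOp_apply_zero, besselVec_apply, unitVec_apply, besselCoeff]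
    push_cast at h ⊢
    simp only [add_zero, add_assoc, one_add_one_eq_two] at h ⊢
    have h1 : √(μ + 1) ≠ 0 := by positivity
    have h2 : √(μ + 2) ≠ 0 := by positivity
    field_simp
    rw [Real.sq_sqrt (by positivity)]
    linear_combination h
  · have h := besselG_recurrence (show -1 < μ by linarith) (k + 1) x
    simp only [lp.coeFn_smul, lp.coeFn_sub, Pi.smul_apply, Pi.sub_apply, smul_eq_mul, besselOp,
      jacobiOp_apply_succ, besselVec_apply, unitVec_apply, besselCoeff]
    rw [if_neg k.succ_ne_zero]
    push_cast at h ⊢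
    simp only [add_assoc, Nat.reduceAdd] at h ⊢
    norm_num at h ⊢
    have h1 : √(μ + (k + 1)) ≠ 0 := by positivity
    have h2 : √(μ + (k + 2)) ≠ 0 := by positivity
    have h3 : √(μ + (k + 3)) ≠ 0 := by positivity
    field_simp
    rw [Real.sq_sqrt (by positivity)]
    linear_combination h

/-- Symmetry moves 1 - xT onto `besselVec hμ x`. This one identity locates the eigenvalues, proves
orthogonality and computes the Fourier coefficients of `besselVec hμ x`. -/
theorem inner_sub_smul_besselOp {μ : ℝ} (hμ : 0 ≤ μ) (x : ℝ) (f : Ell2) :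
    inner ℝ (f - x • besselOp hμ f) (besselVec hμ x) =
      x / 2 * besselG μ 0 x / √(μ + 1) * f 0 := by
  have hs : inner ℝ (besselOp hμ f) (besselVec hμ x) = inner ℝ f (besselOp hμ (besselVec hμ x)) :=
    isSymmetric_jacobiOp _ _ _ f (besselVec hμ x)
  rw [inner_sub_left, real_inner_smul_left, hs, ← real_inner_smul_right, smul_besselOp_besselVec,
    inner_sub_right, sub_sub_cancel, real_inner_smul_right, real_inner_comm, inner_unitVec]

theorem besselG_one_ne_zero {μ : ℝ} (hμ : 0 ≤ μ) {x : ℝ} (hx : x ≠ 0)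
    (h0 : besselG μ 0 x = 0) : besselG μ 1 x ≠ 0 := by
  intro h1
  have key : ∀ k, besselG μ k x = 0 ∧ besselG μ (k + 1) x = 0 := by
    intro k
    induction k with
    | zero => exact ⟨h0, h1⟩
    | succ k ih =>
      refine ⟨ih.2, ?_⟩
      have h := besselG_recurrence (show -1 < μ by linarith) k x
      rw [ih.1, ih.2, zero_add, mul_zero] at h
      exact (mul_eq_zero.1 h).resolve_left hx
  -- A common zero would annihilate every order, but a large enough order cannot vanish at x.
  obtain ⟨k, hk⟩ := exists_nat_gt (|x ^ 2 / 4| * Real.exp |x ^ 2 / 4|)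
  exact mul_ne_zero (pow_ne_zero k (by positivity)) (besselClifford_ne_zero_of_lt
    (show 0 ≤ μ + k by positivity) (by linarith)) (key k).1

/-- The nonzero real zeros of `besselG μ 0`. -/
def besselZeros (μ : ℝ) : Set ℝ := {x | x ≠ 0 ∧ besselG μ 0 x = 0}

theorem neg_mem_besselZeros {μ x : ℝ} (hx : x ∈ besselZeros μ) : -x ∈ besselZeros μ :=
  ⟨neg_ne_zero.2 hx.1, (besselG_zero_neg μ x).trans hx.2⟩

theorem besselOp_besselVec {μ : ℝ} (hμ : 0 ≤ μ) {z : ℝ} (hz : z ∈ besselZeros μ) :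
    besselOp hμ (besselVec hμ z) = z⁻¹ • besselVec hμ z := by
  have h := smul_besselOp_besselVec hμ z
  rw [hz.2, mul_zero, zero_div, zero_smul, sub_zero] at h
  nth_rewrite 2 [← h]
  rw [inv_smul_smul₀ hz.1]

theorem norm_besselVec_sq_of_mem {μ : ℝ} (hμ : 0 ≤ μ) {z : ℝ} (hz : z ∈ besselZeros μ) :
    ‖besselVec hμ z‖ ^ 2 = z ^ 2 * besselG μ 1 z ^ 2 / 2 := by
  rw [norm_besselVec_sq, besselD, hz.2]
  ring

theorem norm_besselVec_ne_zero {μ : ℝ} (hμ : 0 ≤ μ) {z : ℝ} (hz : z ∈ besselZeros μ) :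
    ‖besselVec hμ z‖ ≠ 0 := by
  have h1 := besselG_one_ne_zero hμ hz.1 hz.2
  have hz1 := hz.1
  rw [← pow_ne_zero_iff two_ne_zero, norm_besselVec_sq_of_mem hμ hz]
  positivity

theorem exists_eq_smul_besselVec {μ : ℝ} (hμ : 0 ≤ μ) {f : Ell2} (hf0 : f ≠ 0) {a : ℝ}
    (hf : besselOp hμ f = a • f) :
    ∃ z ∈ besselZeros μ, ∃ b : ℝ, f = b • besselVec hμ z := by
  have hc : ∀ k, besselCoeff μ k ≠ 0 := fun k => (besselCoeff_pos hμ k).ne'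
  have ha : a ≠ 0 := by
    rintro rfl
    rw [zero_smul] at hf
    exact hf0 (eq_zero_of_jacobiOp_eq_zero (besselCoeff_pos hμ) (antitone_besselCoeff hμ) hf)
  have hf1 : f 0 ≠ 0 := fun h => hf0 (eq_zero_of_jacobiOp_eq_smul hc hf h)
  have h := inner_sub_smul_besselOp hμ a⁻¹ f
  rw [hf, inv_smul_smul₀ ha, sub_self, inner_zero_left] at h
  have hz : a⁻¹ ∈ besselZeros μ := by
    refine ⟨inv_ne_zero ha, ?_⟩
    have hs : √(μ + 1) ≠ 0 := by positivity
    by_contra hG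
    have : a⁻¹ / 2 * besselG μ 0 a⁻¹ / √(μ + 1) * f 0 ≠ 0 := by positivity
    exact this h.symm
  refine ⟨a⁻¹, hz, f 0 / besselVec hμ a⁻¹ 0, ?_⟩
  have hv : besselVec hμ a⁻¹ 0 ≠ 0 := by
    rw [besselVec_apply]
    exact mul_ne_zero (by positivity) (besselG_one_ne_zero hμ hz.1 hz.2)
  refine sub_eq_zero.1
    -- The scalar was chosen so that the difference of the two eigenvectors has first entry 0.
    (eq_zero_of_jacobiOp_eq_smul (h := abs_besselCoeff_le hμ) hc (a := a) ?_ ?_)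
  · change besselOp hμ _ = _
    rw [map_sub, map_smul, hf, besselOp_besselVec hμ hz, inv_inv, smul_sub, smul_comm]
  · rw [lp.coeFn_sub, lp.coeFn_smul, Pi.sub_apply, Pi.smul_apply, smul_eq_mul,
      div_mul_cancel₀ _ hv, sub_self]

theorem orthonormal_besselVec {μ : ℝ} (hμ : 0 ≤ μ) :
    Orthonormal ℝ fun z : besselZeros μ => ‖besselVec hμ z‖⁻¹ • besselVec hμ z := by
  refine ⟨fun z => ?_, fun z w hzw => ?_⟩
  · rw [norm_smul, norm_inv, norm_norm, inv_mul_cancel₀ (norm_besselVec_ne_zero hμ z.2)]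
  · have h := inner_sub_smul_besselOp hμ w (besselVec hμ z)
    rw [besselOp_besselVec hμ z.2, w.2.2, mul_zero, zero_div, zero_mul, smul_smul,
      inner_sub_left, real_inner_smul_left] at h
    have hne : 1 - (w : ℝ) * (z : ℝ)⁻¹ ≠ 0 := by
      rw [sub_ne_zero, ← div_eq_mul_inv, ne_eq, eq_div_iff z.2.1, one_mul]
      exact fun h => hzw (Subtype.ext h)
    have h0 : inner ℝ (besselVec hμ z) (besselVec hμ w) = 0 :=
      (mul_eq_zero.1 (show (1 - (w : ℝ) * (z : ℝ)⁻¹) * _ = 0 by rw [← h]; ring)).resolve_left hne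
    simp [real_inner_smul_left, real_inner_smul_right, h0]

theorem span_besselVec_orthogonal {μ : ℝ} (hμ : 0 ≤ μ) :
    (Submodule.span ℝ (Set.range fun z : besselZeros μ =>
      ‖besselVec hμ z‖⁻¹ • besselVec hμ z))ᗮ = ⊥ := by
  rw [eq_bot_iff, ← ContinuousLinearMap.orthogonalComplement_iSup_eigenspaces_eq_bot
    (isCompactOperator_jacobiOp _ _ (abs_besselCoeff_le hμ) (tendsto_besselCoeff hμ))
    (isSymmetric_jacobiOp _ _ _)]
  refine Submodule.orthogonal_le (iSup_le fun a f hf => ?_)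
  rw [Module.End.mem_eigenspace_iff] at hf
  rcases eq_or_ne f 0 with rfl | hf0
  · exact Submodule.zero_mem _
  obtain ⟨z, hz, b, rfl⟩ := exists_eq_smul_besselVec hμ hf0 hf
  have : b • besselVec hμ z =
      (b * ‖besselVec hμ z‖) • (‖besselVec hμ z‖⁻¹ • besselVec hμ z) := by
    rw [smul_smul, mul_assoc, mul_inv_cancel₀ (norm_besselVec_ne_zero hμ hz), mul_one]
  rw [this]
  exact Submodule.smul_mem _ _ (Submodule.subset_span ⟨⟨z, hz⟩, rfl⟩)

/-- The Hilbert basis of normalized eigenvectors of `besselOp`. -/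
noncomputable def besselBasis {μ : ℝ} (hμ : 0 ≤ μ) : HilbertBasis (besselZeros μ) ℝ Ell2 :=
  HilbertBasis.mkOfOrthogonalEqBot (orthonormal_besselVec hμ) (span_besselVec_orthogonal hμ)

theorem hasSum_inner_besselVec {μ : ℝ} (hμ : 0 ≤ μ) (f : Ell2) :
    HasSum (fun z : besselZeros μ => inner ℝ (besselVec hμ z) f ^ 2 / ‖besselVec hμ z‖ ^ 2)
      (‖f‖ ^ 2) := by
  have h := (besselBasis hμ).hasSum_inner_mul_inner f f
  rw [real_inner_self_eq_norm_sq] at h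
  refine h.congr_fun fun z => ?_
  have hb : besselBasis hμ z = ‖besselVec hμ z‖⁻¹ • besselVec hμ z :=
    congrFun (HilbertBasis.coe_mkOfOrthogonalEqBot (orthonormal_besselVec hμ) _) z
  rw [hb, real_inner_smul_left, real_inner_smul_right, real_inner_comm]
  ring

/-- Parseval for `unitVec 0`, which is Rayleigh's sum over the zeros. Its convergence keeps the
zeros from accumulating. -/
theorem hasSum_inv_sq_besselZeros {μ : ℝ} (hμ : 0 ≤ μ) :
    HasSum (fun z : besselZeros μ => 2 * (μ + 1) / (z : ℝ) ^ 2) 1 := by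
  have h := hasSum_inner_besselVec hμ (unitVec 0)
  have h1 : ‖unitVec 0‖ ^ 2 = 1 := by
    rw [← real_inner_self_eq_norm_sq, inner_unitVec, unitVec_apply, if_pos rfl]
  rw [h1] at h
  refine h.congr_fun fun z => ?_
  have hz := z.2.1
  have hG := besselG_one_ne_zero hμ z.2.1 z.2.2
  rw [norm_besselVec_sq_of_mem hμ z.2, real_inner_comm, inner_unitVec, besselVec_apply, mul_pow,
    Real.sq_sqrt (by positivity)]
  simp only [Nat.cast_zero, add_zero, zero_add]
  field_simp

theorem hasSum_besselZeros {μ : ℝ} (hμ : 0 ≤ μ) {x : ℝ} (hG : besselG μ 0 x ≠ 0) :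
    HasSum (fun z : besselZeros μ => x ^ 2 * besselG μ 0 x ^ 2 / ((z : ℝ) - x) ^ 2)
      (x * besselD μ 0 x) := by
  have h := (hasSum_inner_besselVec hμ (besselVec hμ x)).mul_left 2
  rw [norm_besselVec_sq, mul_div_cancel₀ _ two_ne_zero] at h
  refine h.congr_fun fun z => ?_
  have hz := z.2.1
  have hG1 := besselG_one_ne_zero hμ z.2.1 z.2.2
  have hne : (z : ℝ) - x ≠ 0 := by
    rw [sub_ne_zero]; rintro rfl; exact hG z.2.2
  have hi := inner_sub_smul_besselOp hμ x (besselVec hμ z)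
  rw [besselOp_besselVec hμ z.2, smul_smul, inner_sub_left, real_inner_smul_left,
    besselVec_apply] at hi
  simp only [Nat.cast_zero, add_zero, zero_add] at hi
  have hs : √(μ + 1) ≠ 0 := by positivity
  have hi' : inner ℝ (besselVec hμ z) (besselVec hμ x) =
      x / 2 * besselG μ 0 x * besselG μ 1 z * z / (z - x) := by
    rw [eq_div_iff hne]
    field_simp at hi ⊢
    linear_combination hi
  rw [norm_besselVec_sq_of_mem hμ z.2, hi']
  field_simp

/-- The zeros index a Hilbert basis of an infinite-dimensional space. -/
theorem besselZeros_infinite {μ : ℝ} (hμ : 0 ≤ μ) : (besselZeros μ).Infinite := by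
  intro hfin
  have := hfin.fintype
  have hfd : FiniteDimensional ℝ Ell2 :=
    ((besselBasis hμ).toOrthonormalBasis).toBasis.finiteDimensional_of_finite
  have ho : Orthonormal ℝ unitVec := by
    rw [orthonormal_iff_ite]
    intro i j
    rw [inner_unitVec, unitVec_apply]
  exact not_finite_iff_infinite.2 inferInstance ho.linearIndependent.finite

theorem finite_besselZeros_abs_le {μ : ℝ} (hμ : 0 ≤ μ) (r : ℝ) :
    {z ∈ besselZeros μ | |z| ≤ r}.Finite := by
  have h := (hasSum_inv_sq_besselZeros hμ).summable.tendsto_cofinite_zero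
  have h' := h.eventually_lt_const (show 0 < 2 * (μ + 1) / (r ^ 2 + 1) by positivity)
  rw [Filter.eventually_cofinite] at h'
  refine (h'.image Subtype.val).subset fun z hz => ⟨⟨z, hz.1⟩, ?_, rfl⟩
  have hz1 := hz.1.1
  have : z ^ 2 ≤ r ^ 2 + 1 := by nlinarith [sq_abs z, abs_nonneg z, hz.2]
  change ¬ (2 * (μ + 1) / z ^ 2 < _)
  rw [not_lt]
  gcongr

/-! ### Enumeration of the positive zeros -/

theorem besselJ_eq_zero_iff_mem {μ x : ℝ} (hx : 0 < x) : besselJ μ x = 0 ↔ x ∈ besselZeros μ := by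
  have : (x / 2) ^ μ ≠ 0 := (Real.rpow_pos_of_pos (half_pos hx) μ).ne'
  simp [besselJ_eq_mul_besselG μ hx.ne', besselZeros, this, hx.ne']

/-- This makes the infimum in `besselZero` an attained minimum, excluding the default value of
`sInf` on the empty set. -/
theorem exists_isLeast_besselZeros_gt {μ : ℝ} (hμ : 0 ≤ μ) (r : ℝ) :
    ∃ z, IsLeast {x | r < x ∧ x ∈ besselZeros μ} z := by
  obtain ⟨z, hz, hzr⟩ := (besselZeros_infinite hμ).exists_notMem_finite
    (finite_besselZeros_abs_le hμ r)
  have hz' : |z| ∈ {x | r < x ∧ x ∈ besselZeros μ} := by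
    refine ⟨by by_contra h; exact hzr ⟨hz, not_lt.1 h⟩, ?_⟩
    rcases abs_choice z with h | h <;> rw [h]
    · exact hz
    · exact neg_mem_besselZeros hz
  have hfin : {x | (r < x ∧ x ∈ besselZeros μ) ∧ x ≤ |z|}.Finite :=
    (finite_besselZeros_abs_le hμ (max |r| |(|z|)|)).subset fun y hy =>
      ⟨hy.1.2, abs_le_max_abs_abs hy.1.1.le hy.2⟩
  obtain ⟨w, hw, hmin⟩ := Set.exists_min_image _ id hfin ⟨|z|, hz', le_rfl⟩
  refine ⟨w, hw.1, fun y hy => ?_⟩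
  rcases le_total y |z| with h | h
  · exact hmin y ⟨hy, h⟩
  · exact hw.2.trans h

theorem besselZero_nonneg_and_isLeast {μ : ℝ} (hμ : 0 ≤ μ) (k : ℕ) :
    0 ≤ besselZero μ k ∧
      IsLeast {x | besselZero μ k < x ∧ x ∈ besselZeros μ} (besselZero μ (k + 1)) := by
  have key : ∀ k, 0 ≤ besselZero μ k →
      IsLeast {x | besselZero μ k < x ∧ x ∈ besselZeros μ} (besselZero μ (k + 1)) := by
    intro k hk
    obtain ⟨z, hz⟩ := exists_isLeast_besselZeros_gt hμ (besselZero μ k)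
    have he : {x | besselZero μ k < x ∧ besselJ μ x = 0} =
        {x | besselZero μ k < x ∧ x ∈ besselZeros μ} := by
      ext x
      exact and_congr_right fun h => besselJ_eq_zero_iff_mem (hk.trans_lt h)
    rw [besselZero, he, hz.csInf_eq]
    exact hz
  have h0 : ∀ k, 0 ≤ besselZero μ k := by
    intro k
    induction k with
    | zero => exact le_rfl
    | succ k ih => exact ih.trans (key k ih).1.1.le
  exact ⟨h0 k, key k (h0 k)⟩

theorem strictMono_besselZero {μ : ℝ} (hμ : 0 ≤ μ) : StrictMono (besselZero μ) :=
  strictMono_nat_of_lt_succ fun k => (besselZero_nonneg_and_isLeast hμ k).2.1.1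

theorem besselZero_succ_pos {μ : ℝ} (hμ : 0 ≤ μ) (k : ℕ) : 0 < besselZero μ (k + 1) :=
  strictMono_besselZero hμ k.succ_pos

theorem besselZero_succ_mem {μ : ℝ} (hμ : 0 ≤ μ) (k : ℕ) :
    besselZero μ (k + 1) ∈ besselZeros μ :=
  (besselZero_nonneg_and_isLeast hμ k).2.1.2

theorem exists_besselZero_eq {μ : ℝ} (hμ : 0 ≤ μ) {z : ℝ} (hz : z ∈ besselZeros μ)
    (hz0 : 0 < z) : ∃ k, besselZero μ (k + 1) = z := by
  by_contra! hne
  have hlt : ∀ k, besselZero μ k < z := by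
    intro k
    induction k with
    | zero => exact hz0
    | succ k ih => exact lt_of_le_of_ne ((besselZero_nonneg_and_isLeast hμ k).2.2 ⟨ih, hz⟩) (hne k)
  refine Set.infinite_of_injective_forall_mem
    ((strictMono_besselZero hμ).injective.comp (add_left_injective 1)) (fun k => ?_)
    (finite_besselZeros_abs_le hμ z)
  refine ⟨besselZero_succ_mem hμ k, ?_⟩
  simp only [Function.comp]
  rw [abs_of_pos (besselZero_succ_pos hμ k)]
  exact (hlt _).le

theorem hasSum_besselZero {μ : ℝ} (hμ : 0 ≤ μ) {f : ℝ → ℝ} {a : ℝ}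
    (h : HasSum (fun z : besselZeros μ => f z) a) :
    HasSum (fun k : ℕ => f (besselZero μ (k + 1)) + f (-besselZero μ (k + 1))) a := by
  let e : ℕ × Bool → besselZeros μ := fun p =>
    bif p.2 then ⟨besselZero μ (p.1 + 1), besselZero_succ_mem hμ p.1⟩
    else ⟨-besselZero μ (p.1 + 1), neg_mem_besselZeros (besselZero_succ_mem hμ p.1)⟩
  have hinj := (strictMono_besselZero hμ).injective
  have he : Function.Bijective e := by
    constructor
    · rintro ⟨k, b⟩ ⟨l, c⟩ hkl
      have hk := besselZero_succ_pos hμ k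
      have hl := besselZero_succ_pos hμ l
      cases b <;> cases c <;> simp only [e, cond_true, cond_false, Subtype.mk.injEq] at hkl
      · rw [Nat.succ_injective (hinj (neg_injective hkl))]
      · linarith
      · linarith
      · rw [Nat.succ_injective (hinj hkl)]
    · rintro ⟨z, hz⟩
      rcases lt_or_gt_of_ne hz.1 with h0 | h0
      · obtain ⟨k, hk⟩ := exists_besselZero_eq hμ (neg_mem_besselZeros hz) (neg_pos.2 h0)
        exact ⟨(k, false), Subtype.ext (by simp [e, hk])⟩
      · obtain ⟨k, hk⟩ := exists_besselZero_eq hμ hz h0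
        exact ⟨(k, true), Subtype.ext (by simp [e, hk])⟩
  have h' := (Equiv.ofBijective e he).hasSum_iff.2 h
  refine h'.prod_fiberwise fun k => ?_
  have hb := hasSum_fintype fun b : Bool =>
    ((fun z : besselZeros μ => f z) ∘ Equiv.ofBijective e he) (k, b)
  rw [Fintype.sum_bool] at hb
  exact hb

theorem hasSum_besselZero_quotient {μ : ℝ} (hμ : 0 ≤ μ) {x : ℝ} (hx : x ≠ 0)
    (hG : besselG μ 0 x ≠ 0) :
    HasSum (fun k : ℕ => (x ^ 2 + besselZero μ (k + 1) ^ 2) /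
      (x ^ 2 - besselZero μ (k + 1) ^ 2) ^ 2) (besselD μ 0 x / (2 * x * besselG μ 0 x ^ 2)) := by
  have h := (hasSum_besselZero hμ (f := fun z => x ^ 2 * besselG μ 0 x ^ 2 / (z - x) ^ 2)
    (hasSum_besselZeros hμ hG)).mul_left (2 * x ^ 2 * besselG μ 0 x ^ 2)⁻¹
  have e : (2 * x ^ 2 * besselG μ 0 x ^ 2)⁻¹ * (x * besselD μ 0 x) =
      besselD μ 0 x / (2 * x * besselG μ 0 x ^ 2) := by field_simp
  rw [e] at h
  refine h.congr_fun fun k => ?_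
  have hk := besselZero_succ_mem hμ k
  set j := besselZero μ (k + 1)
  have h1 : j - x ≠ 0 := by rw [sub_ne_zero]; rintro rfl; exact hG hk.2
  have h2 : -j - x ≠ 0 := by
    rw [sub_ne_zero]; rintro h; rw [← h] at hG; exact hG (neg_mem_besselZeros hk).2
  -- The paired terms combine through 1/(j-x)² + 1/(j+x)² = 2(x²+j²)/(x²-j²)².
  have h3 : x ^ 2 - j ^ 2 = (j - x) * (-j - x) := by ring
  rw [h3]
  field_simp
  ring

theorem eventually_besselG_ne_zero {μ : ℝ} (hμ : 0 ≤ μ) {x : ℝ} (hx : x ≠ 0) :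
    ∀ᶠ y in 𝓝[≠] x, besselG μ 0 y ≠ 0 := by
  have hfin := (finite_besselZeros_abs_le hμ (|x| + 1)).subset (Set.sdiff_subset (t := {x}))
  have h1 : ∀ᶠ y in 𝓝 x, y ∉ {z ∈ besselZeros μ | |z| ≤ |x| + 1} \ {x} :=
    hfin.isClosed.isOpen_compl.mem_nhds (by simp)
  have h2 : ∀ᶠ y in 𝓝 x, |y| < |x| + 1 :=
    continuous_abs.continuousAt.eventually_lt_const (lt_add_one |x|)
  filter_upwards [nhdsWithin_le_nhds h1, nhdsWithin_le_nhds h2,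
    nhdsWithin_le_nhds (eventually_ne_nhds hx), self_mem_nhdsWithin] with y hy1 hy2 hy3 hy4 hy
  exact hy1 ⟨⟨⟨hy3, hy⟩, hy2.le⟩, hy4⟩

/-! ### Wronskians -/

/-- The Wronskian of `J_μ` and `J_{μ+1}`, in terms of these functions. -/
noncomputable def besselW (μ x : ℝ) : ℝ :=
  besselJ μ x ^ 2 + besselJ (μ + 1) x ^ 2 - (2 * μ + 1) / x * besselJ μ x * besselJ (μ + 1) x

theorem hasDerivAt_besselJ_add_one {μ : ℝ} (hμ : -1 < μ) {x : ℝ} (hx : x ≠ 0) :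
    HasDerivAt (besselJ (μ + 1)) (besselJ μ x - (μ + 1) / x * besselJ (μ + 1) x) x := by
  refine (hasDerivAt_besselJ (by linarith) hx).congr_deriv ?_
  rw [besselJ_recurrence hμ hx, show μ + 1 + 1 = μ + 2 by ring]
  ring

theorem besselW_eq {μ : ℝ} (hμ : -1 < μ) {x : ℝ} (hx : x ≠ 0) :
    besselW μ x = ((x / 2) ^ μ) ^ 2 * (besselD μ 0 x / x) := by
  have h := besselG_recurrence hμ 0 x
  have h1 := besselJ_add_nat_eq μ 1 hx
  simp only [Nat.cast_zero, Nat.cast_one, add_zero, zero_add] at h h1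
  rw [besselW, besselD, h1, besselJ_eq_mul_besselG μ hx]
  simp only [zero_add]
  field_simp
  linear_combination ((x / 2) ^ μ) ^ 2 * besselG μ 0 x * h

theorem besselW_nonneg {μ : ℝ} (hμ : 0 ≤ μ) {x : ℝ} (hx : x ≠ 0) : 0 ≤ besselW μ x := by
  have h : 0 ≤ x * besselD μ 0 x := (hasSum_besselG_sq hμ x).nonneg fun k => by positivity
  have e : besselD μ 0 x / x = x * besselD μ 0 x / x ^ 2 := by field_simp
  rw [besselW_eq (by linarith) hx, e]
  positivity

theorem differentiableAt_lommelR (n : ℕ) (ν : ℝ) {x : ℝ} (hx : x ≠ 0) :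
    DifferentiableAt ℝ (lommelR n ν) x := by
  unfold lommelR
  refine DifferentiableAt.fun_sum fun k _ => DifferentiableAt.const_mul ?_ _
  exact (differentiableAt_id.div_const 2).zpow (Or.inl (by simpa using hx))

/-- With a = 2(ν+n+1)/x, the recurrence gives W[R_{n+2}, R_{n+1}] = W[R_{n+1}, R_n] - a' R_{n+1}²,
and -a' = 2(ν+n+1)/x² is the new coefficient. -/
theorem wronskian_lommelR {ν : ℝ} (hν : 0 < ν) (n : ℕ) {x : ℝ} (hx : x ≠ 0) :
    wronskian (lommelR (n + 1) ν) (lommelR n ν) x =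
      2 / x ^ 2 * ∑ k ∈ Finset.range (n + 1), (ν + k) * lommelR k ν x ^ 2 := by
  induction n with
  | zero =>
    have h0 : lommelR 0 ν = fun _ => 1 := funext (lommelR_zero hν)
    have h1 : lommelR 1 ν = fun y => 2 * ν / y := funext (lommelR_one hν)
    have h2 : HasDerivAt (fun y : ℝ => 2 * ν / y) (2 * ν * -(x ^ 2)⁻¹) x :=
      (hasDerivAt_inv hx).const_mul (2 * ν)
    rw [wronskian, zero_add, h0, h1, h2.deriv]
    simp [h0]
    ring
  | succ n ih =>
    have hn := (differentiableAt_lommelR n ν hx).hasDerivAt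
    have hn1 := (differentiableAt_lommelR (n + 1) ν hx).hasDerivAt
    have he : lommelR (n + 2) ν =ᶠ[𝓝 x] fun y =>
        2 * (ν + n + 1) * y⁻¹ * lommelR (n + 1) ν y - lommelR n ν y :=
      (eventually_ne_nhds hx).mono fun y hy => by rw [lommelR_recurrence hν n hy]; ring
    have hd := ((((hasDerivAt_inv hx).const_mul (2 * (ν + n + 1))).mul hn1).sub
      hn).congr_of_eventuallyEq he
    rw [Finset.sum_range_succ, mul_add, ← ih, wronskian, wronskian, hd.deriv, he.eq_of_nhds]
    push_cast
    ring

theorem besselJ_eq_lommelR {ν : ℝ} (hν : -1 < ν) (n : ℕ) {x : ℝ} (hx : x ≠ 0) :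
    besselJ ν x = lommelR (n + 1) (ν + 1) x * besselJ (ν + n + 1) x -
      lommelR n (ν + 1) x * besselJ (ν + n + 1 + 1) x := by
  induction n with
  | zero =>
    rw [zero_add, lommelR_one (by linarith), lommelR_zero (by linarith), besselJ_recurrence hν hx,
      Nat.cast_zero, add_zero, show ν + 1 + 1 = ν + 2 by ring, one_mul]
  | succ n ih =>
    have hn : (0 : ℝ) ≤ n := n.cast_nonneg
    rw [ih, lommelR_recurrence (by linarith) n hx,
      besselJ_recurrence (show -1 < ν + n + 1 by linarith) hx]
    push_cast
    rw [show ν + (n + 1 : ℝ) + 1 = ν + n + 1 + 1 by ring,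
      show ν + n + 1 + 1 + 1 = ν + n + 1 + 2 by ring]
    ring

theorem wronskian_besselJ_lommelR_mul {ν : ℝ} (hν : -1 < ν) (n : ℕ) {x : ℝ} (hx : x ≠ 0) :
    wronskian (besselJ ν) (fun y => lommelR n (ν + 1) y * besselJ (ν + n + 1) y) x =
      2 / x ^ 2 * besselJ (ν + n + 1) x ^ 2 *
          ∑ k ∈ Finset.range (n + 1), (ν + k + 1) * lommelR k (ν + 1) x ^ 2 +
        lommelR n (ν + 1) x ^ 2 * besselW (ν + n + 1) x := by
  have hn : (0 : ℝ) ≤ n := n.cast_nonneg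
  have hr := (differentiableAt_lommelR n (ν + 1) hx).hasDerivAt
  have hp := (differentiableAt_lommelR (n + 1) (ν + 1) hx).hasDerivAt
  have hf := hasDerivAt_besselJ (show -1 < ν + n + 1 by linarith) hx
  have hg := hasDerivAt_besselJ_add_one (show -1 < ν + n + 1 by linarith) hx
  have he : besselJ ν =ᶠ[𝓝 x] fun y => lommelR (n + 1) (ν + 1) y * besselJ (ν + n + 1) y -
      lommelR n (ν + 1) y * besselJ (ν + n + 1 + 1) y :=
    (eventually_ne_nhds hx).mono fun y hy => besselJ_eq_lommelR hν n hy
  have hd := ((hp.mul hf).sub (hr.mul hg)).congr_of_eventuallyEq he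
  have hW := wronskian_lommelR (show 0 < ν + 1 by linarith) n hx
  simp only [add_right_comm ν 1] at hW
  rw [wronskian] at hW
  have hq : deriv (fun y => lommelR n (ν + 1) y * besselJ (ν + n + 1) y) x = _ :=
    (hr.mul hf).deriv
  rw [wronskian, hd.deriv, he.eq_of_nhds, hq, besselW]
  linear_combination besselJ (ν + n + 1) x ^ 2 * hW

theorem wronskian_besselJ_lommelR_mul_eq_tsum {ν : ℝ} (hν : -1 < ν) (n : ℕ) {x : ℝ} (hx : x ≠ 0)
    (hG : besselG (ν + n + 1) 0 x ≠ 0) :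
    wronskian (besselJ ν) (fun y => lommelR n (ν + 1) y * besselJ (ν + n + 1) y) x =
      2 * besselJ (ν + n + 1) x ^ 2 * (lommelR n (ν + 1) x ^ 2 *
          (∑' k : ℕ, (x ^ 2 + besselZero (ν + n + 1) (k + 1) ^ 2) /
            (x ^ 2 - besselZero (ν + n + 1) (k + 1) ^ 2) ^ 2) +
        1 / x ^ 2 * ∑ k ∈ Finset.range (n + 1), (ν + k + 1) * lommelR k (ν + 1) x ^ 2) := by
  have hn : (0 : ℝ) ≤ n := n.cast_nonneg
  have hμ : 0 ≤ ν + n + 1 := by linarith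
  rw [wronskian_besselJ_lommelR_mul hν n hx, (hasSum_besselZero_quotient hμ hx hG).tsum_eq,
    besselW_eq (by linarith) hx, besselJ_eq_mul_besselG _ hx]
  field_simp
  ring

theorem continuousAt_wronskian_besselJ_lommelR_mul {ν : ℝ} (hν : -1 < ν) (n : ℕ) {x : ℝ}
    (hx : x ≠ 0) :
    ContinuousAt
      (wronskian (besselJ ν) fun y => lommelR n (ν + 1) y * besselJ (ν + n + 1) y) x := by
  have hn : (0 : ℝ) ≤ n := n.cast_nonneg
  have he := (eventually_ne_nhds hx).mono fun y hy => wronskian_besselJ_lommelR_mul hν n hy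
  have hR : ∀ k, ContinuousAt (lommelR k (ν + 1)) x := fun k =>
    (differentiableAt_lommelR k (ν + 1) hx).continuousAt
  have hJ := (hasDerivAt_besselJ (show -1 < ν + n + 1 by linarith) hx).continuousAt
  have hJ1 := (hasDerivAt_besselJ (show -1 < ν + n + 1 + 1 by linarith) hx).continuousAt
  have hx2 : x ^ 2 ≠ 0 := pow_ne_zero 2 hx
  refine ContinuousAt.congr ?_ (EventuallyEq.symm he)
  unfold besselW
  fun_prop (disch := assumption)

end BesselLommel

theorem proposition3p1 (ν : ℝ) (hν : -1 < ν) (m : ℕ) (hm : 1 ≤ m)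
    (x : ℝ) (hx0 : x ≠ 0) (hx : 0 < x ∨ ∃ n : ℤ, ν = n) :
    DifferentiableAt ℝ (BesselLommel.besselJ ν) x ∧
    DifferentiableAt ℝ
      (fun y => BesselLommel.lommelR (m - 1) (ν + 1) y * BesselLommel.besselJ (ν + m) y) x ∧
    -- away from the zeros of `J_{ν+m}`: the series converges and the formula holds
    (BesselLommel.besselJ (ν + m) x ≠ 0 →
      Summable (fun k : ℕ =>
        (x ^ 2 + BesselLommel.besselZero (ν + m) (k + 1) ^ 2) /
          (x ^ 2 - BesselLommel.besselZero (ν + m) (k + 1) ^ 2) ^ 2) ∧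
      BesselLommel.wronskian (BesselLommel.besselJ ν)
          (fun y => BesselLommel.lommelR (m - 1) (ν + 1) y * BesselLommel.besselJ (ν + m) y) x =
        2 * BesselLommel.besselJ (ν + m) x ^ 2 *
          (BesselLommel.lommelR (m - 1) (ν + 1) x ^ 2 *
              (∑' k : ℕ, (x ^ 2 + BesselLommel.besselZero (ν + m) (k + 1) ^ 2) /
                (x ^ 2 - BesselLommel.besselZero (ν + m) (k + 1) ^ 2) ^ 2) +
            1 / x ^ 2 * ∑ k ∈ Finset.range m,
              (ν + k + 1) * BesselLommel.lommelR k (ν + 1) x ^ 2)) ∧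
    -- at a zero of `J_{ν+m}`: the right-hand side has a removable singularity,
    -- and the formula holds with its limit as value
    (BesselLommel.besselJ (ν + m) x = 0 →
      Tendsto (fun y : ℝ =>
          2 * BesselLommel.besselJ (ν + m) y ^ 2 *
            (BesselLommel.lommelR (m - 1) (ν + 1) y ^ 2 *
                (∑' k : ℕ, (y ^ 2 + BesselLommel.besselZero (ν + m) (k + 1) ^ 2) /
                  (y ^ 2 - BesselLommel.besselZero (ν + m) (k + 1) ^ 2) ^ 2) +
              1 / y ^ 2 * ∑ k ∈ Finset.range m,
                (ν + k + 1) * BesselLommel.lommelR k (ν + 1) y ^ 2))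
        (𝓝[≠] x)
        (𝓝 (BesselLommel.wronskian (BesselLommel.besselJ ν)
          (fun y => BesselLommel.lommelR (m - 1) (ν + 1) y *
            BesselLommel.besselJ (ν + m) y) x))) ∧
    -- the Wronskian is nonnegative
    0 ≤ BesselLommel.wronskian (BesselLommel.besselJ ν)
      (fun y => BesselLommel.lommelR (m - 1) (ν + 1) y * BesselLommel.besselJ (ν + m) y) x := by
  obtain ⟨n, rfl⟩ : ∃ n, m = n + 1 := ⟨m - 1, by omega⟩
  have hn : (0 : ℝ) ≤ n := n.cast_nonneg
  have hμ : 0 ≤ ν + n + 1 := by linarith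
  have hcast : ν + ((n + 1 : ℕ) : ℝ) = ν + n + 1 := by push_cast; ring
  simp only [hcast, Nat.add_one_sub_one]
  have hJ := BesselLommel.besselJ_eq_mul_besselG (ν + n + 1) hx0
  refine ⟨(BesselLommel.hasDerivAt_besselJ hν hx0).differentiableAt,
    (BesselLommel.differentiableAt_lommelR n (ν + 1) hx0).mul
      (BesselLommel.hasDerivAt_besselJ (by linarith) hx0).differentiableAt,
    fun h => ?_, fun h => ?_, ?_⟩
  · have hG : BesselLommel.besselG (ν + n + 1) 0 x ≠ 0 := fun h0 => h (by rw [hJ, h0, mul_zero])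
    exact ⟨(BesselLommel.hasSum_besselZero_quotient hμ hx0 hG).summable,
      BesselLommel.wronskian_besselJ_lommelR_mul_eq_tsum hν n hx0 hG⟩
  -- The Wronskian is continuous at x and agrees with the series formula on a punctured
  -- neighbourhood.
  · refine ((BesselLommel.continuousAt_wronskian_besselJ_lommelR_mul hν n hx0).tendsto.mono_left
      nhdsWithin_le_nhds).congr' ?_
    filter_upwards [BesselLommel.eventually_besselG_ne_zero hμ hx0,
      nhdsWithin_le_nhds (eventually_ne_nhds hx0)] with y hG hy
    exact BesselLommel.wronskian_besselJ_lommelR_mul_eq_tsum hν n hy hG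
  · rw [BesselLommel.wronskian_besselJ_lommelR_mul hν n hx0]
    have hW := BesselLommel.besselW_nonneg hμ hx0
    have hS : 0 ≤ ∑ k ∈ Finset.range (n + 1), (ν + k + 1) *
        BesselLommel.lommelR k (ν + 1) x ^ 2 := Finset.sum_nonneg fun k _ =>
      mul_nonneg (by linarith [k.cast_nonneg (α := ℝ)]) (sq_nonneg _)
    positivity
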